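/- Let $n\ge 2$ and let $\mathcal C_n$ be the simplicial complex on the vertex set $\{1,\dots,2n+1\}$ whose minimal non-faces are $\{i,n+i\}$, $\{i,2n+1\}$ $(1\le i\le n)$ and $\{n+1,\dots,2n\}$. A fan over $\mathcal C_n$ is a map $i\mapsto \mathbf v_i\in\mathbb Z^n$ on the vertices such that, for all faces $I,J$ of $\mathcal C_n$, the vectors $\mathbf v_i$ $(i\in I)$ are linearly independent over $\mathbb R$ and $\mathrm{cone}(I)\cap\mathrm{cone}(J)=\mathrm{cone}(I\cap J)$, where $\mathrm{cone}(I)=\{\sum_{i\in I}\alpha_i\mathbf v_i \mid \alpha_i\ge 0\}\subset\mathbb R^n$. It is complete if the cones of the faces cover $\mathbb R^n$, and nonsingular if for every face $I$ the vectors $\mathbf v_i$ $(i\in I)$ form a part of a basis of $\mathbb Z^n$. For every complete nonsingular fan over $\mathcal C_n$ there is a unique pair $(A,\mathbf b)$ of an $n\times n$ integer matrix $A$ and a vector $\mathbf b\in\mathbb Z^n$ with $$(\mathbf v_{n+1},\dots,\mathbf v_{2n})=-(\mathbf v_1,\dots,\mathbf v_n)A,\qquad \mathbf v_{2n+1}=-(\mathbf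 v_1,\dots,\mathbf v_n)\mathbf b .$$ For integers $a_1,\dots,a_n$ let $C(a_1,\dots,a_n)$ be the $n\times n$ matrix with diagonal entries $1$, with $(1,n)$-entry $a_1$, with $(i,i-1)$-entry $a_i$ for $2\le i\le n$, and with all other entries $0$. Then there is a permutation $\sigma$ of $\{1,\dots,n\}$ such that, after $(A,\mathbf b)$ is replaced by the pair $(A_\sigma,\mathbf b_\sigma)$, where $(A_\sigma)_{ij}=A_{\sigma(i)\sigma(j)}$ and $(\mathbf b_\sigma)_i=b_{\sigma(i)}$, one of the following holds; here $\mathbf a_i$ denotes the $i$-th column of the (new) matrix $A$. - Type 0: $\det A=0$, $A=C(-1,\dots,-1)$, and $\sum_{i=1}^n b_i=1$. - Type 1: $\det A=1$, $A$ is lower triangular with all diagonal entries $1$, and $\mathbf b=\sum_{i=1}^n\mathbf a_i$. - Type 2: $\det A=2$, $A=C(a_1,\dots,a_n)$ with all $a_i=\pm1$ and an odd number of the $a_i$ equal to $1$, and $\mathbf b=\frac12\sum_{i=1}^n\mathbf a_i$. - Type 3: $\det A\ne 0,1,2$, $A=C(a,-1,\dots,-1)$ for an integer $a\ne 0,\pm1$,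 and $\mathbf b=\frac1{\det A}\sum_{i=1}^n\mathbf a_i=(1,0,\dots,0)^T$. -/

import Mathlib

namespace CutCube

open Matrix

/-- The cone in `ℝⁿ` spanned by the integer vectors `v i`, `i ∈ I`; for `I = ∅` it is `{0}`. -/
def cone {ι : Type*} {n : ℕ} (v : ι → Fin n → ℤ) (I : Finset ι) : Set (Fin n → ℝ) :=
  {x | ∃ α : ι → ℝ, (∀ i ∈ I, 0 ≤ α i) ∧ x = ∑ i ∈ I, α i • (fun k => (v i k : ℝ))}

/-- A (simplicial) fan of dimension `n`: a pair `(K, V)` of an abstract simplicial complex `K` on a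
vertex set `ι` and a map `V : ι → ℤⁿ`. The faces in Mathlib's complexes are nonempty; the empty
face would add nothing to the two conditions. -/
structure SimplicialFan (ι : Type*) [DecidableEq ι] (n : ℕ) where
  complex : PreAbstractSimplicialComplex ι
  vec : ι → Fin n → ℤ
  linearIndependent : ∀ I ∈ complex,
    LinearIndependent ℝ (fun i : I => (fun k => (vec i k : ℝ) : Fin n → ℝ))
  cone_inter : ∀ I ∈ complex, ∀ J ∈ complex, cone vec I ∩ cone vec J = cone vec (I ∩ J)

namespace SimplicialFan

variable {ι : Type*} [DecidableEq ι] {n : ℕ}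

/-- The cones of the fan cover `ℝⁿ`. -/
def IsComplete (Δ : SimplicialFan ι n) : Prop :=
  ⋃ I ∈ Δ.complex, cone Δ.vec I = Set.univ

/-- For every face `I`, the vectors `vec i`, `i ∈ I`, form a part of a basis of `ℤⁿ`. -/
def IsNonsingular (Δ : SimplicialFan ι n) : Prop :=
  ∀ I ∈ Δ.complex, ∃ (B : Module.Basis (Fin n) ℤ (Fin n → ℤ)) (e : ι → Fin n),
    Set.InjOn e (I : Set ι) ∧ ∀ i ∈ I, B (e i) = Δ.vec i

end SimplicialFan

/-- The `2n+1` vertices of `C_n`. -/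
abbrev Vertex (n : ℕ) : Type := Fin n ⊕ Fin n ⊕ Unit

/-- The vertex labelled `i` (`1 ≤ i ≤ n`). -/
abbrev low {n : ℕ} (i : Fin n) : Vertex n := Sum.inl i

/-- The vertex labelled `n + i` (`1 ≤ i ≤ n`). -/
abbrev high {n : ℕ} (i : Fin n) : Vertex n := Sum.inr (Sum.inl i)

/-- The vertex labelled `2n + 1`. -/
abbrev cut {n : ℕ} : Vertex n := Sum.inr (Sum.inr ())

/-- The simplicial complex `C_n` whose minimal non-faces are `{i, n+i}` and `{i, 2n+1}`
(`1 ≤ i ≤ n`), and `{n+1, …, 2n}`: the faces are the nonempty sets that contain none of these. -/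
def cutCubeComplex (n : ℕ) : PreAbstractSimplicialComplex (Vertex n) where
  faces := {s | s.Nonempty ∧ (∀ i : Fin n, ¬ ({low i, high i} : Finset (Vertex n)) ⊆ s) ∧
    (∀ i : Fin n, ¬ ({low i, cut} : Finset (Vertex n)) ⊆ s) ∧
    ¬ (Finset.univ.image high : Finset (Vertex n)) ⊆ s}
  isRelLowerSet_faces := by
    rintro s ⟨hs, h1, h2, h3⟩
    exact ⟨hs, fun t hts ht => ⟨ht, fun i h => h1 i (h.trans hts), fun i h => h2 i (h.trans hts),
      fun h => h3 (h.trans hts)⟩⟩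

/-- The pair `(A, b)` is associated with the vectors `v_1, …, v_{2n+1}`:
`(v_{n+1}, …, v_{2n}) = -(v_1, …, v_n) A` and `v_{2n+1} = -(v_1, …, v_n) b`. -/
def IsAssociated {n : ℕ} (v : Vertex n → Fin n → ℤ)
    (A : Matrix (Fin n) (Fin n) ℤ) (b : Fin n → ℤ) : Prop :=
  (∀ j, v (high j) = -∑ i, A i j • v (low i)) ∧ v cut = -∑ i, b i • v (low i)

/-- The matrix with diagonal entries `1`, with `a_1` in position `(1, n)`, with `a_i` in position
`(i, i-1)` for `2 ≤ i ≤ n`, and with all other entries `0` (meant for `n ≥ 2`). -/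
def cyclicMatrix {n : ℕ} (a : Fin n → ℤ) : Matrix (Fin n) (Fin n) ℤ :=
  Matrix.of fun i j =>
    if i = j then 1 else if ((j : ℕ) + 1) % n = (i : ℕ) then a i else 0

/-- `b = (1/q) ∑ⱼ aⱼ`, where `aⱼ` is the `j`-th column of `A`. -/
def IsColumnSumDiv {n : ℕ} (A : Matrix (Fin n) (Fin n) ℤ) (b : Fin n → ℤ) (q : ℤ) : Prop :=
  ∀ i, (b i : ℚ) = (1 / (q : ℚ)) * ∑ j, (A i j : ℚ)

/-- Type 0. -/
def IsTypeZero {n : ℕ} (A : Matrix (Fin n) (Fin n) ℤ) (b : Fin n → ℤ) : Prop :=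
  A.det = 0 ∧ A = cyclicMatrix (fun _ => -1) ∧ ∑ i, b i = 1

/-- Type 1. -/
def IsTypeOne {n : ℕ} (A : Matrix (Fin n) (Fin n) ℤ) (b : Fin n → ℤ) : Prop :=
  A.det = 1 ∧ (∀ i, A i i = 1) ∧ (∀ i j, i < j → A i j = 0) ∧ ∀ i, b i = ∑ j, A i j

/-- Type 2. -/
def IsTypeTwo {n : ℕ} (A : Matrix (Fin n) (Fin n) ℤ) (b : Fin n → ℤ) : Prop :=
  A.det = 2 ∧ ∃ a : Fin n → ℤ, (∀ i, a i = 1 ∨ a i = -1) ∧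
    Odd (Finset.univ.filter fun i => a i = 1).card ∧ A = cyclicMatrix a ∧ IsColumnSumDiv A b 2

/-- Type 3: here `a_1 = a` is the `(1, n)` entry, `a_2 = ⋯ = a_n = -1`, and `b = e_1`. -/
def IsTypeThree {n : ℕ} (A : Matrix (Fin n) (Fin n) ℤ) (b : Fin n → ℤ) : Prop :=
  (A.det ≠ 0 ∧ A.det ≠ 1 ∧ A.det ≠ 2) ∧
    (∃ a : ℤ, a ≠ 0 ∧ a ≠ 1 ∧ a ≠ -1 ∧
      A = cyclicMatrix (fun i => if (i : ℕ) = 0 then a else -1)) ∧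
    IsColumnSumDiv A b A.det ∧ ∀ i, b i = if (i : ℕ) = 0 then 1 else 0

end CutCube

/-!
The facets of `C_n` without the vertex `2n+1` are those of a cross-polytope except
`{n+1, …, 2n}`. Adjacent facets lie on different sides of their common wall, so by nonsingularity
their determinants are opposite units. Starting from `v_1, …, v_n` and replacing `v_i` by `v_{n+i}`
one index at a time, this makes all proper principal minors of `A` equal to `1`; if the last index
`k` is replaced by `2n+1` instead of `n+k`, it makes the determinants of Cramer's rule for `A x = b`
equal to `1`, so the sum of the columns of `A` is `det A • b`. Moreover `v_{2n+1}` lies in none of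
the cones of the facets of the cross-polytope.

A chordless cycle in the digraph of the nonzero off-diagonal entries of `A` gives a principal
submatrix `C(a_1, …, a_m)` with all `a_i ≠ 0`, whose determinant `1 - ∏ i, -a i` is not `1`. Hence
either the digraph is acyclic, and `A` is triangular after a permutation (type 1), or it is a single
cycle through all the vertices. In the latter case put `q = det A`: then `1 + a_i = q b_i` and
`∏ i, (1 - q b_i) = 1 - q`. This is type 0 for `q = 0` and type 2 for `q = 2`. Otherwise `b_i = 1`
for some `i`, by comparing sizes, and all the other `a_j` are `±1`; the position of `v_{2n+1}`
excludes `a_j = 1` (type 3).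
-/

namespace CutCube

open Matrix

theorem intCast_sum_smul {κ : Type*} [Fintype κ] {n : ℕ} (γ : κ → ℤ) (w : κ → Fin n → ℤ) :
    (fun k => (((∑ j, γ j • w j) k : ℤ) : ℝ)) = ∑ j, (γ j : ℝ) • fun k => (w j k : ℝ) := by
  ext k
  simp [Finset.sum_apply]

theorem intCast_sum_smul_mem_cone {ι κ : Type*} [DecidableEq ι] [Fintype κ] {n : ℕ}
    (v : ι → Fin n → ℤ) (f : κ → ι) {γ : κ → ℤ} (hγ : 0 ≤ γ) :
    (fun k => (((∑ j, γ j • v (f j)) k : ℤ) : ℝ)) ∈ cone v (Finset.univ.image f) := by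
  refine ⟨fun i => ∑ j with f j = i, (γ j : ℝ),
    fun i _ => Finset.sum_nonneg fun j _ => Int.cast_nonneg (hγ j), ?_⟩
  rw [intCast_sum_smul, ← Finset.sum_fiberwise_of_maps_to
    (fun j _ => Finset.mem_image_of_mem f (Finset.mem_univ j))]
  refine Finset.sum_congr rfl fun i _ => ?_
  rw [Finset.sum_smul]
  exact Finset.sum_congr rfl fun j hj => by rw [(Finset.mem_filter.1 hj).2]

theorem injective_update {α β : Type*} [DecidableEq α] {f : α → β} (hf : f.Injective) (a : α)
    {b : β} (hb : b ∉ Set.range f) : (Function.update f a b).Injective := by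
  have hne (i : α) : f i ≠ b := fun h => hb ⟨i, h⟩
  intro i j hij
  rw [Function.update_apply, Function.update_apply] at hij
  split_ifs at hij with hi hj hj
  · rw [hi, hj]
  · exact absurd hij.symm (hne j)
  · exact absurd hij (hne i)
  · exact hf hij

namespace SimplicialFan

variable {ι κ κ' : Type*} [DecidableEq ι] [Fintype κ] [Fintype κ'] {n : ℕ} {Δ : SimplicialFan ι n}

/-- Two cones of a fan meet in their common face, so a common point involves no other vertex. -/
theorem coeff_eq_zero_of_sum_eq (Δ : SimplicialFan ι n) {f : κ → ι} {g : κ' → ι}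
    (hf : f.Injective) (hF : Finset.univ.image f ∈ Δ.complex)
    (hG : Finset.univ.image g ∈ Δ.complex) {γ : κ → ℤ} {δ : κ' → ℤ} (hγ : 0 ≤ γ) (hδ : 0 ≤ δ)
    (h : ∑ j, γ j • Δ.vec (f j) = ∑ j, δ j • Δ.vec (g j)) {j : κ} (hj : f j ∉ Set.range g) :
    γ j = 0 := by
  obtain ⟨α, -, hα⟩ : (fun k => (((∑ j, γ j • Δ.vec (f j)) k : ℤ) : ℝ)) ∈
      cone Δ.vec (Finset.univ.image f ∩ Finset.univ.image g) := by
    rw [← Δ.cone_inter _ hF _ hG]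
    exact ⟨intCast_sum_smul_mem_cone Δ.vec f hγ, h ▸ intCast_sum_smul_mem_cone Δ.vec g hδ⟩
  have hindep : LinearIndependent ℝ fun j k => (Δ.vec (f j) k : ℝ) :=
    (Δ.linearIndependent _ hF).comp
      (fun j => ⟨f j, Finset.mem_image_of_mem f (Finset.mem_univ j)⟩)
      fun _ _ hij => hf (congrArg Subtype.val hij)
  rw [intCast_sum_smul, ← Finset.sum_ite_mem, Finset.sum_image hf.injOn] at hα
  have hcoeff := Fintype.linearIndependent_iffₛ.1 hindep (fun j => (γ j : ℝ))
    (fun j => if f j ∈ Finset.univ.image g then α (f j) else 0)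
    (by simpa only [ite_smul, zero_smul] using hα) j
  simpa [Set.mem_range.not.1 hj] using hcoeff

/-- Otherwise `x` and `f k` would lie on the same side of the wall spanned by the other vertices,
and moving the negative coefficients to the left would give a common point of both cones that
involves `x`. -/
theorem coeff_nonpos_of_adjacent (Δ : SimplicialFan ι n) {f : Fin n → ι} (hf : f.Injective)
    {k : Fin n} {x : ι} (hx : x ∉ Set.range f) (hF : Finset.univ.image f ∈ Δ.complex)
    (hF' : Finset.univ.image (Function.update f k x) ∈ Δ.complex) {t : Fin n → ℤ}
    (ht : Δ.vec x = ∑ j, t j • Δ.vec (f j)) : t k ≤ 0 := by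
  by_contra! htk
  have hsum : ∑ j, Function.update t⁻ k 1 j • Δ.vec (Function.update f k x j) =
      ∑ j, t⁺ j • Δ.vec (f j) := by
    have hterm (j : Fin n) : Function.update t⁻ k 1 j • Δ.vec (Function.update f k x j) =
        (if j = k then Δ.vec x else 0) + t⁻ j • Δ.vec (f j) := by
      by_cases hj : j = k
      · subst hj
        simp [negPart_eq_zero.2 htk.le]
      · simp [hj]
    simp only [hterm, Finset.sum_add_distrib, Finset.sum_ite_eq', Finset.mem_univ, if_true, ht]
    rw [← Finset.sum_add_distrib]
    refine Finset.sum_congr rfl fun j _ => ?_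
    rw [← add_smul, ← sub_eq_iff_eq_add.1 (congrFun (posPart_sub_negPart t) j)]
  have hnonneg : 0 ≤ Function.update t⁻ k 1 :=
    le_update_iff.2 ⟨zero_le_one, fun j _ => negPart_nonneg t j⟩
  have h0 := Δ.coeff_eq_zero_of_sum_eq (injective_update hf k hx) hF' hF hnonneg
    (posPart_nonneg t) hsum (j := k) (by rwa [Function.update_self])
  rw [Function.update_self] at h0
  exact one_ne_zero h0

theorem IsNonsingular.exists_basis (hΔ : Δ.IsNonsingular) {f : Fin n → ι} (hf : f.Injective)
    (hF : Finset.univ.image f ∈ Δ.complex) :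
    ∃ B : Module.Basis (Fin n) ℤ (Fin n → ℤ), ∀ j, B j = Δ.vec (f j) := by
  obtain ⟨B, e, he, hB⟩ := hΔ _ hF
  have hmem (j : Fin n) : f j ∈ Finset.univ.image f :=
    Finset.mem_image_of_mem f (Finset.mem_univ j)
  have hinj : (e ∘ f).Injective := fun i j hij => hf (he (hmem i) (hmem j) hij)
  let E := Equiv.ofBijective _ (Finite.injective_iff_bijective.1 hinj)
  exact ⟨B.reindex E.symm, fun j => by simp [E, hB _ (hmem j)]⟩

/-- The determinant of the `n` vectors of an ordered facet, taken as the rows of a matrix. It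
records the orientation of the facet. -/
def facetDet (Δ : SimplicialFan ι n) (f : Fin n → ι) : ℤ :=
  (Matrix.of (Δ.vec ∘ f)).det

theorem IsNonsingular.isUnit_facetDet (hΔ : Δ.IsNonsingular) {f : Fin n → ι} (hf : f.Injective)
    (hF : Finset.univ.image f ∈ Δ.complex) : IsUnit (Δ.facetDet f) := by
  obtain ⟨B, hB⟩ := hΔ.exists_basis hf hF
  have hunit := (Pi.basisFun ℤ (Fin n)).isUnit_det B
  rwa [Pi.basisFun_det_apply, funext hB] at hunit

theorem facetDet_update_of_eq_sum {f : Fin n → ι} {x : ι} {t : Fin n → ℤ}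
    (ht : Δ.vec x = ∑ j, t j • Δ.vec (f j)) (k : Fin n) :
    Δ.facetDet (Function.update f k x) = t k * Δ.facetDet f := by
  rw [facetDet, Function.comp_update, ht]
  exact Matrix.det_updateRow_sum (Matrix.of (Δ.vec ∘ f)) k t

theorem IsNonsingular.facetDet_update (hΔ : Δ.IsNonsingular) {f : Fin n → ι} (hf : f.Injective)
    {k : Fin n} {x : ι} (hx : x ∉ Set.range f) (hF : Finset.univ.image f ∈ Δ.complex)
    (hF' : Finset.univ.image (Function.update f k x) ∈ Δ.complex) :
    Δ.facetDet (Function.update f k x) = -Δ.facetDet f := by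
  obtain ⟨B, hB⟩ := hΔ.exists_basis hf hF
  have ht : Δ.vec x = ∑ j, B.repr (Δ.vec x) j • Δ.vec (f j) := by
    simp only [← hB, B.sum_repr]
  have hdet := facetDet_update_of_eq_sum ht k
  have hunit : IsUnit (B.repr (Δ.vec x) k) :=
    isUnit_of_mul_isUnit_left (hdet ▸ hΔ.isUnit_facetDet (injective_update hf k hx) hF')
  have hnonpos := Δ.coeff_nonpos_of_adjacent hf hx hF hF' ht
  have hneg : B.repr (Δ.vec x) k = -1 :=
    (Int.isUnit_iff.1 hunit).resolve_left fun h => by omega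
  rw [hdet, hneg, neg_one_mul]

end SimplicialFan

section PrincipalMinors

variable {ι R : Type*} [DecidableEq ι] [CommRing R]

theorem det_ite_mem_one [Fintype ι] (I : Finset ι) (M : Matrix ι ι R) :
    (Matrix.of fun i j => if i ∈ I then M i j else (1 : Matrix ι ι R) i j).det =
      (M.submatrix ((↑) : I → ι) (↑)).det := by
  set N : Matrix ι ι R := Matrix.of fun i j => if i ∈ I then M i j else (1 : Matrix ι ι R) i j
  have hzero : ∀ i, i ∉ I → ∀ j, j ∈ I → N i j = 0 := by
    intro i hi j hj
    exact (if_neg hi).trans (Matrix.one_apply_ne fun hij => hi (hij ▸ hj))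
  have hinside : N.toSquareBlockProp (· ∈ I) = M.submatrix ((↑) : I → ι) (↑) := by
    ext i j
    exact if_pos i.2
  have houtside : N.toSquareBlockProp (· ∉ I) = 1 := by
    ext i j
    simp [N, Matrix.toSquareBlockProp_def, i.2, Matrix.one_apply, Subtype.ext_iff]
  rw [Matrix.twoBlockTriangular_det N (· ∈ I) hzero, houtside, Matrix.det_one, mul_one, hinside]
  convert rfl

/-- All proper principal minors of the square matrix `A` are `1`; they are indexed by the sets of
rows and columns that are kept. -/
def ProperPrincipalMinorsEqOne [Fintype ι] (A : Matrix ι ι R) : Prop :=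
  ∀ I : Finset ι, I ≠ Finset.univ → (A.submatrix ((↑) : I → ι) (↑)).det = 1

namespace ProperPrincipalMinorsEqOne

variable [Fintype ι] {A : Matrix ι ι R}

theorem det_submatrix (hA : ProperPrincipalMinorsEqOne A) {κ : Type*} [Fintype κ]
    [DecidableEq κ] {c : κ → ι} (hc : c.Injective) (hs : ¬ c.Surjective) :
    (A.submatrix c c).det = 1 := by
  have hI : Finset.univ.image c ≠ Finset.univ := fun h => hs fun y => by
    simpa using (h.symm ▸ Finset.mem_univ y : y ∈ Finset.univ.image c)
  let e : κ ≃ Finset.univ.image c := Equiv.ofBijective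
    (fun i => ⟨c i, Finset.mem_image_of_mem c (Finset.mem_univ i)⟩)
    ⟨fun i j h => hc (congrArg Subtype.val h), fun ⟨y, hy⟩ => by
      obtain ⟨i, -, rfl⟩ := Finset.mem_image.1 hy
      exact ⟨i, rfl⟩⟩
  rw [← hA _ hI, ← Matrix.det_submatrix_equiv_self e, Matrix.submatrix_submatrix]
  rfl

theorem diag_eq_one [Nontrivial ι] (hA : ProperPrincipalMinorsEqOne A) (i : ι) : A i i = 1 := by
  have h := hA.det_submatrix (c := fun _ : Unit => i) (Function.injective_of_subsingleton _)
    fun hs => by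
      obtain ⟨j, hj⟩ := exists_ne i
      obtain ⟨_, hij⟩ := hs j
      exact hj hij.symm
  simpa using h

theorem submatrix (hA : ProperPrincipalMinorsEqOne A) (σ : Equiv.Perm ι) :
    ProperPrincipalMinorsEqOne (A.submatrix σ σ) := by
  intro I hI
  rw [Matrix.submatrix_submatrix]
  refine hA.det_submatrix (σ.injective.comp Subtype.val_injective) fun hs => hI ?_
  rw [Finset.eq_univ_iff_forall]
  intro i
  obtain ⟨x, hx⟩ := hs (σ i)
  exact σ.injective hx ▸ x.2

end ProperPrincipalMinorsEqOne

end PrincipalMinors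

/-- The vertices of a facet of the cross-polytope with the pairs `low j`, `high j` of opposite
vertices, as an ordered tuple: `high j` for `j ∈ I` and `low j` for `j ∉ I`. All of these facets
except the one for `I = univ` are faces of `C_n`. -/
def crossFacet {n : ℕ} (I : Finset (Fin n)) : Fin n → Vertex n :=
  I.piecewise high low

theorem crossFacet_of_mem {n : ℕ} {I : Finset (Fin n)} {j : Fin n} (hj : j ∈ I) :
    crossFacet I j = high j :=
  Finset.piecewise_eq_of_mem _ _ _ hj

theorem crossFacet_of_notMem {n : ℕ} {I : Finset (Fin n)} {j : Fin n} (hj : j ∉ I) :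
    crossFacet I j = low j :=
  Finset.piecewise_eq_of_notMem _ _ _ hj

theorem crossFacet_empty {n : ℕ} : crossFacet (∅ : Finset (Fin n)) = low :=
  Finset.piecewise_empty _ _

theorem crossFacet_insert {n : ℕ} (I : Finset (Fin n)) (k : Fin n) :
    crossFacet (insert k I) = Function.update (crossFacet I) k (high k) :=
  Finset.piecewise_insert _ _ _ _

theorem crossFacet_injective {n : ℕ} (I : Finset (Fin n)) : (crossFacet I).Injective := by
  intro i j h
  simp only [crossFacet, Finset.piecewise] at h
  split_ifs at h
  · exact Sum.inl_injective (Sum.inr_injective h)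
  · exact Sum.inl_injective h

theorem low_mem_range_crossFacet {n : ℕ} {I : Finset (Fin n)} {i : Fin n} :
    low i ∈ Set.range (crossFacet I) ↔ i ∉ I := by
  refine ⟨?_, fun hi => ⟨i, crossFacet_of_notMem hi⟩⟩
  rintro ⟨j, hj⟩ hi
  by_cases hjI : j ∈ I
  · simp [crossFacet_of_mem hjI] at hj
  · rw [crossFacet_of_notMem hjI, Sum.inl.injEq] at hj
    exact hjI (hj ▸ hi)

theorem high_mem_range_crossFacet {n : ℕ} {I : Finset (Fin n)} {i : Fin n} :
    high i ∈ Set.range (crossFacet I) ↔ i ∈ I := by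
  refine ⟨?_, fun hi => ⟨i, crossFacet_of_mem hi⟩⟩
  rintro ⟨j, hj⟩
  by_cases hjI : j ∈ I
  · rw [crossFacet_of_mem hjI, Sum.inr.injEq, Sum.inl.injEq] at hj
    exact hj ▸ hjI
  · simp [crossFacet_of_notMem hjI] at hj

theorem cut_notMem_range_crossFacet {n : ℕ} (I : Finset (Fin n)) :
    cut ∉ Set.range (crossFacet I) := by
  rintro ⟨j, hj⟩
  by_cases hjI : j ∈ I
  · simp [crossFacet_of_mem hjI] at hj
  · simp [crossFacet_of_notMem hjI] at hj

theorem image_mem_cutCubeComplex {κ : Type*} [Fintype κ] [Nonempty κ] {n : ℕ} {f : κ → Vertex n}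
    (hhigh : ∀ i, low i ∈ Set.range f → high i ∉ Set.range f)
    (hcut : ∀ i, low i ∈ Set.range f → cut ∉ Set.range f) (hne : ∃ i, high i ∉ Set.range f) :
    Finset.univ.image f ∈ cutCubeComplex n := by
  have hrange {x : Vertex n} {s : Finset (Vertex n)} (hs : s ⊆ Finset.univ.image f)
      (hx : x ∈ s) : x ∈ Set.range f := by
    simpa using hs hx
  refine ⟨Finset.univ_nonempty.image f, fun i h => ?_, fun i h => ?_, fun h => ?_⟩
  · exact hhigh i (hrange h (by simp)) (hrange h (by simp))
  · exact hcut i (hrange h (by simp)) (hrange h (by simp))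
  · obtain ⟨i, hi⟩ := hne
    exact hi (hrange h (by simp))

theorem image_crossFacet_mem {n : ℕ} {I : Finset (Fin n)} (hI : I ≠ Finset.univ) :
    Finset.univ.image (crossFacet I) ∈ cutCubeComplex n := by
  obtain ⟨k, hk⟩ : ∃ k, k ∉ I := by simpa [Finset.eq_univ_iff_forall] using hI
  have : Nonempty (Fin n) := ⟨k⟩
  refine image_mem_cutCubeComplex (fun i hlow hhigh => ?_)
    (fun i _ => cut_notMem_range_crossFacet I) ⟨k, mt high_mem_range_crossFacet.1 hk⟩
  exact low_mem_range_crossFacet.1 hlow (high_mem_range_crossFacet.1 hhigh)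

theorem image_update_cut_mem {n : ℕ} (k : Fin n) :
    Finset.univ.image (Function.update high k cut) ∈ cutCubeComplex n := by
  have : Nonempty (Fin n) := ⟨k⟩
  have hlow (i : Fin n) : low i ∉ Set.range (Function.update high k cut) := by
    rintro ⟨j, hj⟩
    rw [Function.update_apply] at hj
    split_ifs at hj
  refine image_mem_cutCubeComplex (fun i hi => absurd hi (hlow i)) (fun i hi => absurd hi (hlow i))
    ⟨k, ?_⟩
  rintro ⟨j, hj⟩
  rw [Function.update_apply] at hj
  split_ifs at hj with hjk
  · cases Sum.inr_injective hj
  · exact hjk (Sum.inl_injective (Sum.inr_injective hj))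

theorem image_cut_mem {n : ℕ} (hn : 0 < n) :
    Finset.univ.image (fun _ : Unit => (cut : Vertex n)) ∈ cutCubeComplex n :=
  image_mem_cutCubeComplex (by simp) (by simp) ⟨⟨0, hn⟩, by simp⟩

section Fan

variable {n : ℕ} {Δ : SimplicialFan (Vertex n) n}

theorem isUnit_facetDet_low (hn : 0 < n) (hΔ : Δ.IsNonsingular)
    (hover : Δ.complex = cutCubeComplex n) : IsUnit (Δ.facetDet low) := by
  have : Nonempty (Fin n) := ⟨⟨0, hn⟩⟩
  rw [← crossFacet_empty]
  exact hΔ.isUnit_facetDet (crossFacet_injective ∅)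
    (hover ▸ image_crossFacet_mem Finset.univ_nonempty.ne_empty.symm)

theorem facetDet_crossFacet (hΔ : Δ.IsNonsingular) (hover : Δ.complex = cutCubeComplex n)
    {I : Finset (Fin n)} (hI : I ≠ Finset.univ) :
    Δ.facetDet (crossFacet I) = (-1) ^ I.card * Δ.facetDet low := by
  induction I using Finset.induction_on with
  | empty => simp [crossFacet_empty]
  | insert k I hk ih =>
    have hI' : I ≠ Finset.univ := fun h => hk (h ▸ Finset.mem_univ k)
    rw [crossFacet_insert, hΔ.facetDet_update (crossFacet_injective I)
      (mt high_mem_range_crossFacet.1 hk) (hover ▸ image_crossFacet_mem hI')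
      (crossFacet_insert I k ▸ hover ▸ image_crossFacet_mem hI), ih hI',
      Finset.card_insert_of_notMem hk]
    ring

theorem facetDet_update_cut (hΔ : Δ.IsNonsingular) (hover : Δ.complex = cutCubeComplex n)
    (k : Fin n) :
    Δ.facetDet (Function.update high k cut) = (-1) ^ n * Δ.facetDet low := by
  have hI : Finset.univ.erase k ≠ Finset.univ := by simp [Finset.erase_eq_self]
  have hupdate : Function.update high k cut =
      Function.update (crossFacet (Finset.univ.erase k)) k cut := by
    ext1 j
    by_cases hj : j = k
    · simp [hj]
    · simp [hj, crossFacet_of_mem]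
  have hcard : (Finset.univ.erase k).card + 1 = n := by
    rw [Finset.card_erase_add_one (Finset.mem_univ k), Finset.card_univ, Fintype.card_fin]
  rw [hupdate, hΔ.facetDet_update (crossFacet_injective _) (cut_notMem_range_crossFacet _)
    (hover ▸ image_crossFacet_mem hI) (hupdate ▸ hover ▸ image_update_cut_mem k),
    facetDet_crossFacet hΔ hover hI]
  have hpow : -(-1 : ℤ) ^ (Finset.univ.erase k).card = (-1) ^ n := by
    rw [← mul_neg_one, ← pow_succ, hcard]
  rw [← hpow, neg_mul]

theorem existsUnique_isAssociated (hn : 0 < n) (hΔ : Δ.IsNonsingular)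
    (hover : Δ.complex = cutCubeComplex n) :
    ∃! p : Matrix (Fin n) (Fin n) ℤ × (Fin n → ℤ), IsAssociated Δ.vec p.1 p.2 := by
  have : Nonempty (Fin n) := ⟨⟨0, hn⟩⟩
  obtain ⟨B, hB⟩ := hΔ.exists_basis (crossFacet_injective ∅)
    (hover ▸ image_crossFacet_mem Finset.univ_nonempty.ne_empty.symm)
  rw [crossFacet_empty] at hB
  have hcoord (x y : Fin n → ℤ) : x = -∑ i, y i • Δ.vec (low i) ↔ y = -B.equivFun x := by
    simp only [← hB, ← Module.Basis.equivFun_symm_apply]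
    rw [eq_comm, neg_eq_iff_eq_neg, LinearEquiv.symm_apply_eq, map_neg]
  refine ⟨(Matrix.of fun i j => -B.equivFun (Δ.vec (high j)) i, -B.equivFun (Δ.vec cut)),
    ⟨fun j => (hcoord _ _).2 rfl, (hcoord _ _).2 rfl⟩, ?_⟩
  rintro ⟨A, b⟩ ⟨hhigh, hcut⟩
  refine Prod.ext ?_ ((hcoord _ _).1 hcut)
  ext i j
  exact congrFun ((hcoord _ (fun i => A i j)).1 (hhigh j)) i

variable {A : Matrix (Fin n) (Fin n) ℤ} {b : Fin n → ℤ}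

theorem facetDet_eq_det_mul {g : Fin n → Vertex n} {N : Matrix (Fin n) (Fin n) ℤ}
    (h : ∀ j, Δ.vec (g j) = ∑ i, N j i • Δ.vec (low i)) :
    Δ.facetDet g = N.det * Δ.facetDet low := by
  rw [SimplicialFan.facetDet, SimplicialFan.facetDet, ← Matrix.det_mul]
  congr 1
  ext j k
  simp [h, Matrix.mul_apply, Finset.sum_apply]

theorem IsAssociated.properPrincipalMinorsEqOne (hA : IsAssociated Δ.vec A b)
    (hΔ : Δ.IsNonsingular) (hover : Δ.complex = cutCubeComplex n) :
    ProperPrincipalMinorsEqOne A := by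
  intro I hI
  obtain ⟨k, -⟩ : ∃ k, k ∉ I := by simpa [Finset.eq_univ_iff_forall] using hI
  have hcoords (j : Fin n) : Δ.vec (crossFacet I j) =
      ∑ i, (Matrix.of fun j i => if j ∈ I then (-Aᵀ) j i
        else (1 : Matrix (Fin n) (Fin n) ℤ) j i) j i • Δ.vec (low i) := by
    by_cases hj : j ∈ I
    · simp [crossFacet_of_mem hj, hj, hA.1]
    · simp [crossFacet_of_notMem hj, hj, Matrix.one_apply]
  have hdet : (-(A.submatrix ((↑) : I → Fin n) (↑))ᵀ).det = (-1) ^ I.card := by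
    change ((-Aᵀ).submatrix _ _).det = _
    rw [← det_ite_mem_one]
    exact (isUnit_facetDet_low k.pos hΔ hover).mul_left_injective
      ((facetDet_eq_det_mul hcoords).symm.trans (facetDet_crossFacet hΔ hover hI))
  rw [Matrix.det_neg, Fintype.card_coe, Matrix.det_transpose] at hdet
  exact (mul_eq_left₀ (pow_ne_zero _ (by norm_num))).1 hdet

theorem IsAssociated.cramer_eq_one (hA : IsAssociated Δ.vec A b) (hΔ : Δ.IsNonsingular)
    (hover : Δ.complex = cutCubeComplex n) (k : Fin n) : A.cramer b k = 1 := by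
  have hcoords (j : Fin n) : Δ.vec (Function.update high k cut j) =
      ∑ i, (-(Aᵀ.updateRow k b)) j i • Δ.vec (low i) := by
    by_cases hj : j = k
    · subst hj
      simp [hA.2]
    · simp [hj, hA.1]
  have hdet : (-(Aᵀ.updateRow k b)).det = (-1) ^ n :=
    (isUnit_facetDet_low k.pos hΔ hover).mul_left_injective
      ((facetDet_eq_det_mul hcoords).symm.trans (facetDet_update_cut hΔ hover k))
  rw [Matrix.det_neg, Fintype.card_fin, ← Matrix.cramer_transpose_apply,
    Matrix.transpose_transpose] at hdet
  exact (mul_eq_left₀ (pow_ne_zero _ (by norm_num))).1 hdet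

theorem IsAssociated.sum_smul_high (hA : IsAssociated Δ.vec A b) (c : Fin n → ℤ) :
    ∑ j, c j • Δ.vec (high j) = -∑ i, (A *ᵥ c) i • Δ.vec (low i) := by
  simp only [hA.1, smul_neg, Finset.sum_neg_distrib, Finset.smul_sum, smul_smul, Matrix.mulVec,
    dotProduct, Finset.sum_smul]
  rw [Finset.sum_comm]
  simp only [mul_comm]

/-- A complementary pair `(c, A c - b)` with `c i = 0` for some `i` would put the vector of `cut`
into the cone of a facet without `cut`. -/
theorem IsAssociated.ne_zero_of_complementary (hA : IsAssociated Δ.vec A b)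
    (hover : Δ.complex = cutCubeComplex n) {c : Fin n → ℤ} (hc : 0 ≤ c) (hle : b ≤ A *ᵥ c)
    (hcompl : ∀ i, c i = 0 ∨ (A *ᵥ c) i = b i) (i : Fin n) : c i ≠ 0 := by
  intro hi
  let I : Finset (Fin n) := {j | c j ≠ 0}
  have hI : I ≠ Finset.univ := fun h =>
    (Finset.mem_filter.1 (h.symm ▸ Finset.mem_univ i : i ∈ I)).2 hi
  have hterm (j : Fin n) : I.piecewise c (A *ᵥ c - b) j • Δ.vec (crossFacet I j) =
      (A *ᵥ c - b) j • Δ.vec (low j) + c j • Δ.vec (high j) := by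
    by_cases hj : c j = 0
    · simp [crossFacet_of_notMem, I, hj]
    · simp [crossFacet_of_mem, I, hj, (hcompl j).resolve_left hj]
  have hcut : ∑ _ : Unit, (1 : ℤ) • Δ.vec cut =
      ∑ j, I.piecewise c (A *ᵥ c - b) j • Δ.vec (crossFacet I j) := by
    simp only [hterm, Finset.sum_add_distrib, hA.sum_smul_high, Pi.sub_apply, sub_smul,
      Finset.sum_sub_distrib, hA.2, Finset.univ_unique, Finset.sum_singleton, one_smul]
    abel
  have h0 := Δ.coeff_eq_zero_of_sum_eq (Function.injective_of_subsingleton _)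
    (hover ▸ image_cut_mem i.pos) (hover ▸ image_crossFacet_mem hI) (γ := 1) zero_le_one
    (Finset.le_piecewise_of_le_of_le I hc (sub_nonneg.2 hle)) hcut (j := ())
    (cut_notMem_range_crossFacet I)
  exact one_ne_zero h0

end Fan

section Cyclic

theorem cyclicMatrix_apply {m : ℕ} (a : Fin (m + 1) → ℤ) (i j : Fin (m + 1)) :
    cyclicMatrix a i j = if i = j then 1 else if i = j + 1 then a i else 0 := by
  have h : (((j : ℕ) + 1) % (m + 1) = (i : ℕ)) ↔ i = j + 1 := by
    rw [Fin.ext_iff, Fin.val_add, Fin.val_one', Nat.add_mod_mod, eq_comm]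
  simp only [cyclicMatrix, Matrix.of_apply, h]

theorem cyclicMatrix_submatrix_addRight {m : ℕ} (a : Fin (m + 1) → ℤ) (k : Fin (m + 1)) :
    (cyclicMatrix a).submatrix (Equiv.addRight k) (Equiv.addRight k) =
      cyclicMatrix (a ∘ Equiv.addRight k) := by
  ext i j
  have h : i + k = j + k + 1 ↔ i = j + 1 := by rw [add_right_comm, add_left_inj]
  simp [cyclicMatrix_apply, h]

variable {m : ℕ}

theorem cyclicMatrix_row (a : Fin (m + 2) → ℤ) (i : Fin (m + 2)) :
    cyclicMatrix a i = Pi.single i 1 + Pi.single (i - 1) (a i) := by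
  ext j
  rw [cyclicMatrix_apply, Pi.add_apply, Pi.single_apply, Pi.single_apply]
  by_cases hij : i = j
  · simp [hij, eq_sub_iff_add_eq]
  · simp [hij, Ne.symm hij, eq_sub_iff_add_eq, eq_comm]

theorem cyclicMatrix_mulVec (a c : Fin (m + 2) → ℤ) (i : Fin (m + 2)) :
    (cyclicMatrix a *ᵥ c) i = c i + a i * c (i - 1) := by
  rw [Matrix.mulVec, cyclicMatrix_row, add_dotProduct, single_dotProduct, single_dotProduct,
    one_mul]

theorem cyclicMatrix_mulVec_indicator {a : Fin (m + 2) → ℤ} {l : Fin (m + 2)} (hl : l ≠ 0)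
    (ha : ∀ i < l, i ≠ 0 → a i = -1) :
    (cyclicMatrix a *ᵥ fun i => if i < l then 1 else 0) = Pi.single 0 1 + Pi.single l (a l) := by
  have hlpos : 0 < l := Fin.pos_iff_ne_zero.2 hl
  ext i
  rw [cyclicMatrix_mulVec, Pi.add_apply]
  by_cases hi : i = 0
  · have hlast : ¬ -1 < l := by
      rw [Fin.lt_def, Fin.coe_neg_one]
      omega
    simp [hi, hlpos, hlast, hl.symm]
  have hprev : i - 1 < l ↔ i ≤ l := by
    have := Fin.val_ne_zero_iff.2 hi
    rw [Fin.lt_def, Fin.le_def, Fin.val_sub_one_of_ne_zero hi]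
    omega
  rcases lt_trichotomy i l with hil | rfl | hil
  · simp [hprev, hil, hil.le, hil.ne, hi, ha i hil hi]
  · simp [hprev, hi]
  · simp [hprev, hil.not_gt, hil.not_ge, hil.ne', hi]

open Fin.CommRing in
theorem cyclic_induction {P : Fin (m + 1) → Prop} {k : Fin (m + 1)} (hk : P k)
    (h : ∀ i, P i → P (i - 1)) (i : Fin (m + 1)) : P i := by
  have hcast (t : ℕ) : P (k - (t : Fin (m + 1))) := by
    induction t with
    | zero => simpa using hk
    | succ t ih =>
      rw [Nat.cast_succ, sub_add_eq_sub_sub]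
      exact h _ ih
  simpa only [Fin.cast_val_eq_self, sub_sub_cancel] using hcast (k - i : Fin (m + 1))

theorem perm_eq_one_or_finRotate (τ : Equiv.Perm (Fin (m + 2)))
    (h : ∀ i, τ i = i ∨ τ i = i + 1) : τ = 1 ∨ τ = finRotate (m + 2) := by
  by_cases hfix : ∃ i, τ i = i
  · obtain ⟨i₀, hi₀⟩ := hfix
    refine Or.inl (Equiv.ext (cyclic_induction (P := fun i => τ i = i) hi₀ fun i hi => ?_))
    refine (h (i - 1)).resolve_right fun hprev => ?_
    rw [sub_add_cancel] at hprev
    simpa using τ.injective (hprev.trans hi.symm)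
  · push Not at hfix
    right
    ext i
    rw [finRotate_apply, (h i).resolve_left (hfix i)]

theorem det_cyclicMatrix (a : Fin (m + 2) → ℤ) : (cyclicMatrix a).det = 1 - ∏ i, -a i := by
  have hne : (1 : Equiv.Perm (Fin (m + 2))) ≠ finRotate (m + 2) := fun h => by
    simpa using congrArg (fun σ : Equiv.Perm (Fin (m + 2)) => σ 0) h
  have hone : ∏ i, cyclicMatrix a ((1 : Equiv.Perm (Fin (m + 2))) i) i = 1 :=
    Finset.prod_eq_one fun i _ => by simp [cyclicMatrix_apply]
  have hrotate : ∏ i, cyclicMatrix a (finRotate (m + 2) i) i = ∏ i, a i := by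
    rw [← Equiv.prod_comp (finRotate (m + 2)) a]
    exact Finset.prod_congr rfl fun i _ => by simp [cyclicMatrix_apply]
  rw [Matrix.det_apply, Fintype.sum_eq_add _ _ hne, hone, hrotate, Equiv.Perm.sign_one,
    sign_finRotate, Finset.prod_neg, Finset.card_univ, Fintype.card_fin]
  · simp only [one_smul, Units.smul_def, Units.val_pow_eq_pow_val, Units.val_neg, Units.val_one,
      smul_eq_mul, Nat.add_one_sub_one]
    ring
  · rintro τ ⟨h1, h2⟩
    obtain ⟨i, hi⟩ : ∃ i, ¬ (τ i = i ∨ τ i = i + 1) := by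
      by_contra! h
      exact (perm_eq_one_or_finRotate τ h).elim h1 h2
    rw [not_or] at hi
    rw [Finset.prod_eq_zero (Finset.mem_univ i), smul_zero]
    rw [cyclicMatrix_apply, if_neg hi.1, if_neg hi.2]

theorem adjugate_cyclicMatrix_diag (a : Fin (m + 2) → ℤ) (k : Fin (m + 2)) :
    (cyclicMatrix a).adjugate k k = 1 := by
  have hrow : (cyclicMatrix a).updateRow k (Pi.single k 1) =
      cyclicMatrix (Function.update a k 0) := by
    funext i
    by_cases hi : i = k
    · subst hi
      simp [cyclicMatrix_row]
    · simp [cyclicMatrix_row, hi]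
  rw [Matrix.adjugate_apply, hrow, det_cyclicMatrix,
    Finset.prod_eq_zero (Finset.mem_univ k) (by simp), sub_zero]

/-- As the matrix is singular, every column of its adjugate lies in its kernel and is constant. -/
theorem adjugate_cyclicMatrix_neg_one (i k : Fin (m + 2)) :
    (cyclicMatrix fun _ : Fin (m + 2) => (-1 : ℤ)).adjugate i k = 1 := by
  set A := cyclicMatrix fun _ : Fin (m + 2) => (-1 : ℤ) with hA
  have hdet : A.det = 0 := by simp [hA, det_cyclicMatrix]
  refine cyclic_induction (P := fun i => A.adjugate i k = 1) (adjugate_cyclicMatrix_diag _ k)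
    (fun i hi => ?_) i
  have hker : (A *ᵥ fun j => A.adjugate j k) i = 0 := by
    have hmul := congrFun (congrFun (Matrix.mul_adjugate A) i) k
    rwa [hdet, zero_smul] at hmul
  rw [hA, cyclicMatrix_mulVec, ← hA] at hker
  linarith

end Cyclic

section ChordlessCycle

variable {α : Type*} {r : α → α → Prop}

theorem rel_cyclic_of_path {m : ℕ} {f : ℕ → α} (hstep : ∀ t < m, r (f t) (f (t + 1)))
    (hclose : r (f m) (f 0)) (i : Fin (m + 1)) : r (f i) (f ((i + 1 : Fin (m + 1)) : ℕ)) := by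
  by_cases hi : i = Fin.last m
  · simpa [hi] using hclose
  · have hlt := Fin.lt_last_iff_ne_last.2 hi
    rw [Fin.val_add_one_of_lt hlt]
    exact hstep i hlt

theorem exists_closedWalk_of_not_wellFounded [Finite α] (hr : ¬ WellFounded r) :
    ∃ (m : ℕ) (c : Fin (m + 1) → α), ∀ i, r (c i) (c (i + 1)) := by
  rw [wellFounded_iff_isEmpty_descending_chain, not_isEmpty_iff] at hr
  obtain ⟨f, hf⟩ := hr
  obtain ⟨i, j, hij, hfij⟩ : ∃ i j, i < j ∧ f i = f j := by
    obtain ⟨i, j, hne, h⟩ := Finite.exists_ne_map_eq_of_infinite f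
    exact hne.lt_or_gt.elim (fun hlt => ⟨i, j, hlt, h⟩) fun hgt => ⟨j, i, hgt, h.symm⟩
  obtain ⟨m, rfl⟩ := Nat.exists_eq_add_of_lt hij
  refine ⟨m, fun t => f (i + m + 1 - t),
    rel_cyclic_of_path (f := fun t => f (i + m + 1 - t)) (fun t ht => ?_) ?_⟩
  · have hpred : i + m + 1 - t = i + m + 1 - (t + 1) + 1 := by omega
    rw [hpred]
    exact hf _
  · have hpred : i + m + 1 - m = i + 1 := by omega
    rw [hpred, Nat.sub_zero, ← hfij]
    exact hf i

open Fin.CommRing in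
theorem exists_chordless_cycle [Finite α] (hr : ¬ WellFounded r) :
    ∃ (m : ℕ) (c : Fin (m + 1) → α), ∀ i j, r (c i) (c j) ↔ j = i + 1 := by
  obtain ⟨m, c, hc⟩ := exists_closedWalk_of_not_wellFounded hr
  induction m using Nat.strong_induction_on with
  | h m ih =>
    by_cases hchord : ∀ i j, r (c i) (c j) → j = i + 1
    · exact ⟨m, c, fun i j => ⟨hchord i j, fun h => h ▸ hc i⟩⟩
    push Not at hchord
    obtain ⟨i, j, hij, hj⟩ := hchord
    -- The chord from `c i` to `c j` closes the part of the walk from `c j` to `c i`.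
    have hlt : ((i - j : Fin (m + 1)) : ℕ) < m := by
      refine Fin.lt_last_iff_ne_last.2 fun hlast => hj ?_
      have hzero : i - j + 1 = 0 := by rw [hlast, Fin.last_add_one]
      rw [sub_add_eq_add_sub, sub_eq_zero] at hzero
      exact hzero.symm
    refine ih _ hlt (fun t => c (j + (t : ℕ)))
      (rel_cyclic_of_path (f := fun t => c (j + (t : Fin (m + 1)))) (fun t _ => ?_) ?_)
    · rw [Nat.cast_succ, ← add_assoc]
      exact hc _
    · rwa [Fin.cast_val_eq_self, Nat.cast_zero, add_zero, add_sub_cancel]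

theorem injective_of_chordless_cycle {m : ℕ} {c : Fin (m + 1) → α}
    (hc : ∀ i j, r (c i) (c j) ↔ j = i + 1) : c.Injective := by
  intro i j hij
  have hprev := (hc (i - 1) i).2 (sub_add_cancel i 1).symm
  rw [hij, hc, sub_add_cancel] at hprev
  exact hprev.symm

end ChordlessCycle

section Dichotomy

variable {ι R : Type*}

/-- The arrows `x ⟶ y`, `x ≠ y`, of the digraph of the nonzero off-diagonal entries of `A`. The
entry of such an arrow is `A y x`, so that `A` is lower triangular if all arrows increase. -/
def OffDiagAdj [Zero R] (A : Matrix ι ι R) (x y : ι) : Prop :=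
  x ≠ y ∧ A y x ≠ 0

theorem exists_perm_lowerTriangular_of_wellFounded [Zero R] {n : ℕ}
    {A : Matrix (Fin n) (Fin n) R} (hA : WellFounded (OffDiagAdj A)) :
    ∃ σ : Equiv.Perm (Fin n), ∀ i j, i < j → A (σ i) (σ j) = 0 := by
  have : IsWellFounded _ (OffDiagAdj A) := ⟨hA⟩
  refine ⟨Tuple.sort (IsWellFounded.rank (OffDiagAdj A)), fun i j hij => ?_⟩
  by_contra hne
  refine (Tuple.monotone_sort (IsWellFounded.rank (OffDiagAdj A)) hij.le).not_gt ?_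
  exact IsWellFounded.rank_lt_of_rel ⟨fun h => hij.ne' (Equiv.injective _ h), hne⟩

theorem submatrix_eq_cyclicMatrix {A : Matrix ι ι ℤ} (hdiag : ∀ i, A i i = 1) {m : ℕ}
    {c : Fin (m + 1) → ι} (hc : ∀ i j, OffDiagAdj A (c i) (c j) ↔ j = i + 1) :
    A.submatrix c c = cyclicMatrix fun i => A (c i) (c (i - 1)) := by
  ext i j
  rw [cyclicMatrix_apply, Matrix.submatrix_apply]
  split_ifs with hij hsucc
  · rw [hij, hdiag]
  · rw [hsucc, add_sub_cancel_right]
  · by_contra hne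
    exact hsucc ((hc j i).1 ⟨fun h => hij (injective_of_chordless_cycle hc h).symm, hne⟩)

/-- A chordless cycle in the digraph of `A` gives a principal minor different from `1`, hence
passes through all vertices. -/
theorem exists_perm_lowerTriangular_or_cyclic {k : ℕ}
    {A : Matrix (Fin (k + 2)) (Fin (k + 2)) ℤ} (hA : ProperPrincipalMinorsEqOne A) :
    ∃ σ : Equiv.Perm (Fin (k + 2)), (∀ i j, i < j → A (σ i) (σ j) = 0) ∨
      ∃ a : Fin (k + 2) → ℤ, (∀ i, a i ≠ 0) ∧ A.submatrix σ σ = cyclicMatrix a := by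
  by_cases hwf : WellFounded (OffDiagAdj A)
  · obtain ⟨σ, hσ⟩ := exists_perm_lowerTriangular_of_wellFounded hwf
    exact ⟨σ, Or.inl hσ⟩
  obtain ⟨m, c, hc⟩ := exists_chordless_cycle hwf
  have hinj := injective_of_chordless_cycle hc
  have hcyc := submatrix_eq_cyclicMatrix hA.diag_eq_one hc
  have hne (i : Fin (m + 1)) : A (c i) (c (i - 1)) ≠ 0 :=
    ((hc (i - 1) i).2 (sub_add_cancel i 1).symm).2
  obtain _ | m := m
  · exact absurd rfl ((hc 0 0).2 (Fin.ext (by omega))).1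
  have hsurj : c.Surjective := by
    by_contra hs
    have hdet := hA.det_submatrix hinj hs
    rw [hcyc, det_cyclicMatrix, sub_eq_self] at hdet
    exact Finset.prod_ne_zero_iff.2 (fun i _ => neg_ne_zero.2 (hne i)) hdet
  obtain rfl : m = k := by
    simpa using Fintype.card_of_bijective (f := c) ⟨hinj, hsurj⟩
  exact ⟨Equiv.ofBijective c ⟨hinj, hsurj⟩, Or.inr ⟨_, hne, hcyc⟩⟩

end Dichotomy

/-- The properties of the pair `(A, b)` of a nonsingular fan over `C_n` from which the types are
derived. The last one encodes that `v_{2n+1}` lies in no cone over a face of `C_n` without the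
vertex `cut`: the linear complementarity problem `0 ≤ c`, `b ≤ A c`, `c i * (A c - b) i = 0` has no
solution `c` with a vanishing coordinate. -/
structure IsAdmissible {ι : Type*} [Fintype ι] [DecidableEq ι] (A : Matrix ι ι ℤ)
    (b : ι → ℤ) : Prop where
  minors : ProperPrincipalMinorsEqOne A
  cramer : ∀ i, A.cramer b i = 1
  ne_zero_of_complementary : ∀ c : ι → ℤ, 0 ≤ c → b ≤ A *ᵥ c →
    (∀ i, c i = 0 ∨ (A *ᵥ c) i = b i) → ∀ i, c i ≠ 0

theorem IsAssociated.isAdmissible {n : ℕ} {Δ : SimplicialFan (Vertex n) n}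
    {A : Matrix (Fin n) (Fin n) ℤ} {b : Fin n → ℤ} (hA : IsAssociated Δ.vec A b)
    (hΔ : Δ.IsNonsingular) (hover : Δ.complex = cutCubeComplex n) : IsAdmissible A b where
  minors := hA.properPrincipalMinorsEqOne hΔ hover
  cramer := hA.cramer_eq_one hΔ hover
  ne_zero_of_complementary _ hc hle hcompl := hA.ne_zero_of_complementary hover hc hle hcompl

namespace IsAdmissible

section General

variable {ι : Type*} [Fintype ι] [DecidableEq ι] {A : Matrix ι ι ℤ} {b : ι → ℤ}

theorem submatrix (h : IsAdmissible A b) (σ : Equiv.Perm ι) :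
    IsAdmissible (A.submatrix σ σ) (b ∘ σ) := by
  refine ⟨h.minors.submatrix σ, fun i => ?_, fun c hc hle hcompl i => ?_⟩
  · rw [Matrix.cramer_submatrix_equiv]
    simp [Function.comp_assoc, h.cramer]
  · rw [Matrix.submatrix_mulVec_equiv] at hle hcompl
    have hne := h.ne_zero_of_complementary (c ∘ σ.symm) (fun j => hc _)
      (fun j => by simpa using hle (σ.symm j)) (fun j => by simpa using hcompl (σ.symm j)) (σ i)
    simpa using hne

theorem sum_row (h : IsAdmissible A b) (i : ι) : ∑ j, A i j = A.det * b i := by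
  simpa [Matrix.mulVec, dotProduct, h.cramer] using congrFun (Matrix.mulVec_cramer A b) i

theorem exists_pos [Nonempty ι] (h : IsAdmissible A b) : ∃ i, 0 < b i := by
  by_contra! hb
  exact h.ne_zero_of_complementary 0 le_rfl (by rwa [Matrix.mulVec_zero]) (fun _ => Or.inl rfl)
    (Classical.arbitrary ι) rfl

end General

theorem isColumnSumDiv {n : ℕ} {A : Matrix (Fin n) (Fin n) ℤ} {b : Fin n → ℤ}
    (h : IsAdmissible A b) (hA : A.det ≠ 0) : IsColumnSumDiv A b A.det := by
  intro i
  rw [← Int.cast_sum, h.sum_row, Int.cast_mul, one_div,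
    inv_mul_cancel_left₀ (Int.cast_ne_zero.2 hA)]

end IsAdmissible

theorem eq_one_of_one_sub_mul_dvd {q b : ℤ} (h0 : q ≠ 0) (h1 : q ≠ 1) (hb : 0 < b)
    (h : 1 - q * b ∣ 1 - q) : b = 1 := by
  have hle : |1 - q * b| ≤ |1 - q| :=
    Int.le_of_dvd (abs_pos.2 (by omega)) ((abs_dvd_abs _ _).2 h)
  rcases h0.lt_or_gt with hq | hq
  · rw [abs_of_pos (by nlinarith), abs_of_pos (by linarith)] at hle
    nlinarith
  · have hq2 : 2 ≤ q := by omega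
    rw [abs_of_neg (by nlinarith), abs_of_neg (by linarith)] at hle
    nlinarith

namespace IsAdmissible

variable {k : ℕ} {A : Matrix (Fin (k + 2)) (Fin (k + 2)) ℤ} {a b : Fin (k + 2) → ℤ}

theorem isTypeOne (h : IsAdmissible A b) (hA : ∀ i j, i < j → A i j = 0) : IsTypeOne A b := by
  have hdet : A.det = 1 := by
    rw [Matrix.det_of_isLowerTriangular A fun i j hij => hA i j hij]
    exact Finset.prod_eq_one fun i _ => h.minors.diag_eq_one i
  exact ⟨hdet, h.minors.diag_eq_one, hA, fun i => by rw [h.sum_row, hdet, one_mul]⟩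

theorem one_add_eq_det_mul (h : IsAdmissible (cyclicMatrix a) b) (i : Fin (k + 2)) :
    1 + a i = (cyclicMatrix a).det * b i := by
  rw [← h.sum_row, cyclicMatrix_row]
  simp [Finset.sum_add_distrib]

theorem isTypeZero (h : IsAdmissible (cyclicMatrix a) b) (hdet : (cyclicMatrix a).det = 0) :
    IsTypeZero (cyclicMatrix a) b := by
  obtain rfl : a = fun _ => -1 := by
    ext i
    have hi := h.one_add_eq_det_mul i
    rw [hdet, zero_mul] at hi
    linarith
  refine ⟨hdet, rfl, ?_⟩
  rw [← h.cramer 0, Matrix.cramer_eq_adjugate_mulVec]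
  simp [Matrix.mulVec, dotProduct, adjugate_cyclicMatrix_neg_one]

theorem isTypeTwo (h : IsAdmissible (cyclicMatrix a) b) (hdet : (cyclicMatrix a).det = 2) :
    IsTypeTwo (cyclicMatrix a) b := by
  have hprod : ∏ i, -a i = -1 := by linarith [det_cyclicMatrix a]
  have ha (i : Fin (k + 2)) : a i = 1 ∨ a i = -1 := by
    have hdvd : -a i ∣ -1 := hprod ▸ Finset.dvd_prod_of_mem (fun j => -a j) (Finset.mem_univ i)
    exact Int.isUnit_iff.1 (IsUnit.neg_iff _ |>.1 (isUnit_of_dvd_unit hdvd isUnit_one.neg))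
  have hsign (i : Fin (k + 2)) : -a i = if a i = 1 then -1 else 1 := by
    rcases ha i with h | h <;> simp [h]
  refine ⟨hdet, a, ha, ?_, rfl, hdet ▸ h.isColumnSumDiv (by simp [hdet])⟩
  rw [Finset.prod_congr rfl fun i _ => hsign i, Finset.prod_ite, Finset.prod_const,
    Finset.prod_const_one, mul_one] at hprod
  exact (neg_one_pow_eq_neg_one_iff_odd (by norm_num)).1 hprod

/-- For `q = det A`, the identities `∏ i, (1 - q * b i) = 1 - q` and `-a i = 1 - q * b i` leave no
room for more than one factor different from `±1`. -/
theorem exists_eq_one (h : IsAdmissible (cyclicMatrix a) b) (h0 : (cyclicMatrix a).det ≠ 0)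
    (h1 : (cyclicMatrix a).det ≠ 1) (h2 : (cyclicMatrix a).det ≠ 2) :
    ∃ i, b i = 1 ∧ ∀ j ≠ i, a j = -1 ∧ b j = 0 ∨ a j = 1 ∧ b j ≤ 0 := by
  obtain ⟨i, hi⟩ := h.exists_pos
  have hprod : ∏ j, -a j = 1 - (cyclicMatrix a).det := by linarith [det_cyclicMatrix a]
  have hrow := h.one_add_eq_det_mul
  set q := (cyclicMatrix a).det
  have hbi : b i = 1 := by
    refine eq_one_of_one_sub_mul_dvd h0 h1 hi ?_
    rw [← hprod, show 1 - q * b i = -a i by linarith [hrow i]]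
    exact Finset.dvd_prod_of_mem (fun j => -a j) (Finset.mem_univ i)
  have hcofactor : ∏ j ∈ Finset.univ.erase i, -a j = 1 := by
    have hai : -a i = 1 - q := by linarith [hbi ▸ hrow i]
    rw [← Finset.mul_prod_erase _ _ (Finset.mem_univ i), hai] at hprod
    exact (mul_eq_left₀ (sub_ne_zero.2 h1.symm)).1 hprod
  refine ⟨i, hbi, fun j hj => ?_⟩
  have hunit : IsUnit (a j) := by
    rw [← IsUnit.neg_iff]
    exact isUnit_of_dvd_one (hcofactor ▸ Finset.dvd_prod_of_mem (fun j => -a j)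
      (Finset.mem_erase.2 ⟨hj, Finset.mem_univ j⟩))
  rcases Int.isUnit_iff.1 hunit with haj | haj
  · refine Or.inr ⟨haj, ?_⟩
    by_contra! hbj
    have hqb : q * b j = 2 := by rw [← hrow, haj]; rfl
    have hq : q ≤ 2 := Int.le_of_dvd two_pos (Dvd.intro _ hqb)
    have hq0 : 0 < q := (mul_pos_iff_of_pos_right hbj).1 (by omega)
    omega
  · refine Or.inl ⟨haj, ?_⟩
    have hqb : q * b j = 0 := by rw [← hrow, haj]; rfl
    exact (mul_eq_zero.1 hqb).resolve_left h0

/-- If `l` is the first index with `l ≠ 0` and `a l = 1`, then the indicator function of `{i < l}`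
solves the complementarity problem. -/
theorem eq_neg_one (h : IsAdmissible (cyclicMatrix a) b) (hb0 : b 0 = 1)
    (hb : ∀ j ≠ 0, a j = -1 ∧ b j = 0 ∨ a j = 1 ∧ b j ≤ 0) {j : Fin (k + 2)} (hj : j ≠ 0) :
    a j = -1 ∧ b j = 0 := by
  refine (hb j hj).resolve_right fun haj => ?_
  obtain ⟨l, ⟨hl0, hl⟩, hmin⟩ := wellFounded_lt.has_min {j | j ≠ 0 ∧ a j = 1} ⟨j, hj, haj.1⟩
  have hlt (i : Fin (k + 2)) (hi : i < l) (hi0 : i ≠ 0) : a i = -1 ∧ b i = 0 :=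
    (hb i hi0).resolve_right fun hone => hmin i ⟨hi0, hone.1⟩ hi
  have hmul := cyclicMatrix_mulVec_indicator hl0 fun i hi hi0 => (hlt i hi hi0).1
  have hnonpos (i : Fin (k + 2)) (hi : i ≠ 0) : b i ≤ 0 :=
    (hb i hi).elim (fun hi => hi.2.le) And.right
  refine h.ne_zero_of_complementary (fun i => if i < l then 1 else 0) (fun i => ?_) (fun i => ?_)
    (fun i => ?_) l (if_neg (lt_irrefl l))
  · dsimp only
    split_ifs <;> simp
  · rw [hmul, hl]
    by_cases hi : i = 0
    · simp [hi, hb0, hl0.symm]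
    · refine (hnonpos i hi).trans ?_
      rw [Pi.add_apply, Pi.single_apply, Pi.single_apply]
      positivity
  · refine or_iff_not_imp_left.2 fun hne => ?_
    have hil : i < l := not_not.1 fun hil => hne (if_neg hil)
    rw [hmul]
    by_cases hi : i = 0
    · simp [hi, hb0, hl0.symm]
    · simp [hi, hil.ne, (hlt i hil hi).2]

theorem isTypeThree (h : IsAdmissible (cyclicMatrix a) b) (hb0 : b 0 = 1)
    (hb : ∀ j ≠ 0, a j = -1 ∧ b j = 0 ∨ a j = 1 ∧ b j ≤ 0) (h0 : (cyclicMatrix a).det ≠ 0)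
    (h1 : (cyclicMatrix a).det ≠ 1) (h2 : (cyclicMatrix a).det ≠ 2) :
    IsTypeThree (cyclicMatrix a) b := by
  have hdet : (cyclicMatrix a).det = 1 + a 0 := by rw [h.one_add_eq_det_mul, hb0, mul_one]
  refine ⟨⟨h0, h1, h2⟩, ⟨a 0, by omega, by omega, by omega, congrArg cyclicMatrix ?_⟩,
    h.isColumnSumDiv h0, fun i => ?_⟩
  · ext i
    by_cases hi : i = 0
    · simp [hi]
    · rw [if_neg (Fin.val_ne_zero_iff.2 hi), (h.eq_neg_one hb0 hb hi).1]
  · by_cases hi : i = 0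
    · simp [hi, hb0]
    · rw [if_neg (Fin.val_ne_zero_iff.2 hi), (h.eq_neg_one hb0 hb hi).2]

theorem exists_type_of_cyclic (h : IsAdmissible (cyclicMatrix a) b) (ha : ∀ i, a i ≠ 0) :
    IsTypeZero (cyclicMatrix a) b ∨ IsTypeTwo (cyclicMatrix a) b ∨
      ∃ i, IsTypeThree ((cyclicMatrix a).submatrix (Equiv.addRight i) (Equiv.addRight i))
        (b ∘ Equiv.addRight i) := by
  by_cases h0 : (cyclicMatrix a).det = 0
  · exact Or.inl (h.isTypeZero h0)
  by_cases h2 : (cyclicMatrix a).det = 2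
  · exact Or.inr (Or.inl (h.isTypeTwo h2))
  have h1 : (cyclicMatrix a).det ≠ 1 := by
    rw [det_cyclicMatrix, Ne, sub_eq_self]
    exact Finset.prod_ne_zero_iff.2 fun i _ => neg_ne_zero.2 (ha i)
  obtain ⟨i, hi, hj⟩ := h.exists_eq_one h0 h1 h2
  have hrot := h.submatrix (Equiv.addRight i)
  rw [← Matrix.det_submatrix_equiv_self (Equiv.addRight i)] at h0 h1 h2
  rw [cyclicMatrix_submatrix_addRight] at hrot h0 h1 h2
  refine Or.inr (Or.inr ⟨i, ?_⟩)
  rw [cyclicMatrix_submatrix_addRight]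
  exact hrot.isTypeThree (by simpa using hi) (fun j hj0 => hj (j + i) (by simpa using hj0))
    h0 h1 h2

theorem exists_type (h : IsAdmissible A b) :
    ∃ σ : Equiv.Perm (Fin (k + 2)),
      IsTypeZero (A.submatrix σ σ) (b ∘ σ) ∨ IsTypeOne (A.submatrix σ σ) (b ∘ σ) ∨
      IsTypeTwo (A.submatrix σ σ) (b ∘ σ) ∨ IsTypeThree (A.submatrix σ σ) (b ∘ σ) := by
  obtain ⟨σ, htri | ⟨a, ha, hcyc⟩⟩ := exists_perm_lowerTriangular_or_cyclic h.minors
  · exact ⟨σ, Or.inr (Or.inl ((h.submatrix σ).isTypeOne htri))⟩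
  rcases (hcyc ▸ h.submatrix σ).exists_type_of_cyclic ha with hzero | htwo | ⟨i, hthree⟩
  · exact ⟨σ, Or.inl (hcyc ▸ hzero)⟩
  · exact ⟨σ, Or.inr (Or.inr (Or.inl (hcyc ▸ htwo)))⟩
  · rw [← hcyc, Matrix.submatrix_submatrix] at hthree
    exact ⟨(Equiv.addRight i).trans σ, Or.inr (Or.inr (Or.inr hthree))⟩

end IsAdmissible

end CutCube

theorem proposition3p3_general (n : ℕ) (hn : 2 ≤ n)
    (Δ : CutCube.SimplicialFan (CutCube.Vertex n) n)
    (hover : Δ.complex = CutCube.cutCubeComplex n) (hnonsing : Δ.IsNonsingular) :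
    (∃! p : Matrix (Fin n) (Fin n) ℤ × (Fin n → ℤ), CutCube.IsAssociated Δ.vec p.1 p.2) ∧
    ∀ (A : Matrix (Fin n) (Fin n) ℤ) (b : Fin n → ℤ), CutCube.IsAssociated Δ.vec A b →
      ∃ σ : Equiv.Perm (Fin n),
        CutCube.IsTypeZero (A.submatrix σ σ) (b ∘ σ) ∨
        CutCube.IsTypeOne (A.submatrix σ σ) (b ∘ σ) ∨
        CutCube.IsTypeTwo (A.submatrix σ σ) (b ∘ σ) ∨
        CutCube.IsTypeThree (A.submatrix σ σ) (b ∘ σ) := by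
  refine ⟨CutCube.existsUnique_isAssociated (by omega) hnonsing hover, fun A b hA => ?_⟩
  obtain ⟨k, rfl⟩ := Nat.exists_eq_add_of_le' hn
  exact (hA.isAdmissible hnonsing hover).exists_type

theorem proposition3p3 (n : ℕ) (hn : 2 ≤ n)
    (Δ : CutCube.SimplicialFan (CutCube.Vertex n) n)
    (hover : Δ.complex = CutCube.cutCubeComplex n)
    (hcomplete : Δ.IsComplete) (hnonsing : Δ.IsNonsingular) :
    (∃! p : Matrix (Fin n) (Fin n) ℤ × (Fin n → ℤ), CutCube.IsAssociated Δ.vec p.1 p.2) ∧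
    ∀ (A : Matrix (Fin n) (Fin n) ℤ) (b : Fin n → ℤ), CutCube.IsAssociated Δ.vec A b →
      ∃ σ : Equiv.Perm (Fin n),
        CutCube.IsTypeZero (A.submatrix σ σ) (b ∘ σ) ∨
        CutCube.IsTypeOne (A.submatrix σ σ) (b ∘ σ) ∨
        CutCube.IsTypeTwo (A.submatrix σ σ) (b ∘ σ) ∨
        CutCube.IsTypeThree (A.submatrix σ σ) (b ∘ σ) :=
  proposition3p3_general n hn Δ hover hnonsing
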